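/- Let $n\ge 0$ and let $a_1,\dots,a_n$ be nonzero integers; put $\varepsilon_k=\operatorname{sign}(a_k)$. The standard diagram $D$ of the unoriented rational link encoded by the continued fraction $$[0,a_1,\dots,a_n]=\cfrac{1}{a_1+\cfrac{1}{a_2+\ddots+\cfrac{1}{a_n}}}$$ is the following 4-plat. It has four horizontal strands, numbered $1,2,3,4$ from top to bottom; at the left end strand $1$ is joined to strand $2$ and strand $3$ to strand $4$. From left to right there are $n$ twist boxes, the $k$-th one consisting of $|a_k|$ consecutive crossings of strands $2$ and $3$ if $k$ is odd, and of strands $1$ and $2$ if $k$ is even. In each crossing of the $k$-th box the overcrossing strand runs from the lower left to the upper right if the twist sign $(-1)^{k-1}\varepsilon_k$ is $+1$, and from the upper left to the lower right if it is $-1$. At the right end strand $1$ is joined to $2$ and $3$ to $4$ if $n$ is odd, and $2$ is joined to $3$ and $1$ to $4$ if $n$ is even. Let $K_n\in\mathbb Z[A,A^{-1}]$ be the Kauffman bracket of $D$, that is, with $d=-A^{2}-A^{-2}$, $$K_n=\langle D\rangle=\sum_{s}A^{\alpha(s)-\beta(s)}\,d^{\,\ell(s)-1},$$ where $s$ runs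 over all choices of an $A$- or a $B$-smoothing at each crossing, $\alpha(s)$ and $\beta(s)$ are the numbers of $A$- and of $B$-smoothings, and $\ell(s)$ is the number of loops obtained. (The $A$-smoothing merges the two regions swept out when the overcrossing strand is turned counterclockwise until it meets the undercrossing strand; the $B$-smoothing merges the other two.) Write $[m]_q=1+q+\cdots+q^{m-1}$. Then $$K_n=(-A)^{3\sum_{k=1}^n(-1)^{k-1}a_k}\;\begin{bmatrix}1&0\end{bmatrix}M_n M_{n-1}\cdots M_1\begin{bmatrix}1\\ d\end{bmatrix},$$ where $$M_k=\begin{bmatrix}-A^{2(-1)^k\varepsilon_k}\,[|a_k|]_{-A^{4(-1)^k\varepsilon_k}} & \bigl(-A^{4(-1)^k}\bigr)^{a_k}\\[4pt] 1&0\end{bmatrix}$$ and, in exponents and subscripts, $-A^{m}$ means $-(A^{m})$. -/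

import Mathlib

namespace RationalLink

/-! ### Diagrams on four horizontal strands

Strands are numbered `0, 1, 2, 3` from top to bottom. A diagram is drawn from left to right; it is
cut by vertical lines into slices, each of which contains exactly one crossing of two neighbouring
strands. -/

/-- A crossing of the strands `pos` and `pos + 1` (counted from the top, starting with `0`).
It is `rising` when the overcrossing strand runs from the lower left to the upper right corner of
the crossing, and otherwise the overcrossing strand runs from the upper left to the lower right. -/
structure Crossing where
  pos : Fin 3
  rising : Bool

/-- The position of the upper one of the two strands that meet at a crossing. -/
def Crossing.upper (c : Crossing) : Fin 4 := c.pos.castSucc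

/-- The position of the lower one of the two strands that meet at a crossing. -/
def Crossing.lower (c : Crossing) : Fin 4 := c.pos.succ

/-- The way in which the four right ends are joined: `side` joins the first strand to the second
and the third to the fourth; `nested` joins the second to the third and the first to the fourth. -/
inductive Closing where
  | side
  | nested

/-- The pairs of strands that a closing joins. -/
inductive Closing.Joins : Closing → Fin 4 → Fin 4 → Prop
  | side_top : Closing.Joins Closing.side 0 1
  | side_bottom : Closing.Joins Closing.side 2 3
  | nested_inner : Closing.Joins Closing.nested 1 2
  | nested_outer : Closing.Joins Closing.nested 0 3

/-- An unoriented link diagram on four horizontal strands: the list of its crossings from left to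
right and the closing at the right. At the left, the first strand is always joined to the second
and the third to the fourth. -/
structure Diagram where
  crossings : List Crossing
  closing : Closing

/-- A state of a diagram: a choice of one of the two smoothings at each crossing, `true` for the
`A`-smoothing and `false` for the `B`-smoothing. -/
abbrev Diagram.State (D : Diagram) : Type := Fin D.crossings.length → Bool

/-- The points in which the vertical cutting lines meet the strands: `(t, j)` is the point of the
`j`-th strand on the `t`-th line, the `t`-th slice lying between the lines `t` and `t + 1`. -/
abbrev Diagram.Point (D : Diagram) : Type := Fin (D.crossings.length + 1) × Fin 4

/-- Whether a smoothing of the crossing `c` is vertical, that is, joins the upper left corner to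
the lower left corner and the upper right corner to the lower right corner, thereby merging the
regions above and below the crossing. Otherwise it is horizontal, that is, it joins the upper left
corner to the upper right one and the lower left corner to the lower right one.

The `A`-regions of a crossing are those swept out when the overcrossing strand is turned
counterclockwise until it meets the undercrossing strand. They are the regions above and below a
rising crossing, and the regions to the left and to the right of any other crossing. The
`A`-smoothing merges the two `A`-regions and the `B`-smoothing merges the two others. -/
def Crossing.vertical (c : Crossing) (smoothing : Bool) : Bool := c.rising == smoothing

/-- The arcs of the crossingless diagram that a state gives: the strands that pass a crossing, the
two arcs of each smoothed crossing, and the arcs of the closings at the left and at the right. -/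
inductive Diagram.Arc (D : Diagram) (s : D.State) : D.Point → D.Point → Prop
  | pass (t : Fin D.crossings.length) (j : Fin 4) (hu : j ≠ (D.crossings.get t).upper)
      (hl : j ≠ (D.crossings.get t).lower) :
      Diagram.Arc D s (t.castSucc, j) (t.succ, j)
  | horizontal_upper (t : Fin D.crossings.length)
      (h : (D.crossings.get t).vertical (s t) = false) :
      Diagram.Arc D s (t.castSucc, (D.crossings.get t).upper) (t.succ, (D.crossings.get t).upper)
  | horizontal_lower (t : Fin D.crossings.length)
      (h : (D.crossings.get t).vertical (s t) = false) :
      Diagram.Arc D s (t.castSucc, (D.crossings.get t).lower) (t.succ, (D.crossings.get t).lower)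
  | vertical_left (t : Fin D.crossings.length)
      (h : (D.crossings.get t).vertical (s t) = true) :
      Diagram.Arc D s (t.castSucc, (D.crossings.get t).upper)
        (t.castSucc, (D.crossings.get t).lower)
  | vertical_right (t : Fin D.crossings.length)
      (h : (D.crossings.get t).vertical (s t) = true) :
      Diagram.Arc D s (t.succ, (D.crossings.get t).upper) (t.succ, (D.crossings.get t).lower)
  | left_top : Diagram.Arc D s (0, 0) (0, 1)
  | left_bottom : Diagram.Arc D s (0, 2) (0, 3)
  | right (i j : Fin 4) (h : D.closing.Joins i j) :
      Diagram.Arc D s (Fin.last D.crossings.length, i) (Fin.last D.crossings.length, j)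

/-- The number of loops of a state: the number of connected components of the crossingless diagram,
that is, of classes of the equivalence relation generated by the arcs. -/
noncomputable def Diagram.loops (D : Diagram) (s : D.State) : ℕ := Nat.card (Quot (D.Arc s))

/-! ### The Kauffman bracket -/

/-- The variable `A` of the Laurent polynomial ring `ℤ[A, A⁻¹]`, as an invertible element. -/
noncomputable def varA : (LaurentPolynomial ℤ)ˣ where
  val := LaurentPolynomial.T 1
  inv := LaurentPolynomial.T (-1)
  val_inv := by rw [← LaurentPolynomial.T_add]; simp
  inv_val := by rw [← LaurentPolynomial.T_add]; simp

/-- The loop value `d = -A² - A⁻²`. -/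
noncomputable def loopValue : LaurentPolynomial ℤ :=
  -((varA ^ (2 : ℤ) : (LaurentPolynomial ℤ)ˣ) : LaurentPolynomial ℤ)
    - ((varA ^ (-2 : ℤ) : (LaurentPolynomial ℤ)ˣ) : LaurentPolynomial ℤ)

/-- The Kauffman bracket of an unoriented diagram, normalized to `1` on a circle without crossings:
the sum over all states of `A` to the power of the number of `A`-smoothings minus the number of
`B`-smoothings, times `d` to the power of the number of loops minus one. (There is always at least
one loop.) -/
noncomputable def Diagram.bracket (D : Diagram) : LaurentPolynomial ℤ :=
  ∑ s : D.State,
    (∏ t, if s t then (varA : LaurentPolynomial ℤ)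
      else ((varA⁻¹ : (LaurentPolynomial ℤ)ˣ) : LaurentPolynomial ℤ))
      * loopValue ^ (D.loops s - 1)

/-! ### Standard diagrams of rational links -/

/-- The crossings in the `k`-th twist box of the standard diagram encoded by `[0, a₁, …, aₙ]`.
The box twists the second and the third strand if `k` is odd, and the first and the second strand
if `k` is even. Its crossings are rising exactly when the twist sign `(-1)^(k-1) * sign (a k)` is
positive. -/
def boxCrossing (a : ℕ → ℤ) (k : ℕ) : Crossing where
  pos := if Odd k then 1 else 0
  rising := decide (0 < (-1) ^ (k - 1) * (a k).sign)

/-- The standard diagram of the unoriented rational link encoded by the continued fraction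
`[0, a₁, …, aₙ]`: the twist boxes `1, …, n` follow each other from left to right, the `k`-th one
consisting of `|a k|` crossings, and the closing at the right depends on the parity of `n`.
Only the values `a 1, …, a n` are used. -/
def standardDiagram (n : ℕ) (a : ℕ → ℤ) : Diagram where
  crossings := (List.range' 1 n).flatMap fun k => List.replicate (a k).natAbs (boxCrossing a k)
  closing := if Odd n then Closing.side else Closing.nested

/-! ### The matrices -/

/-- The `q`-integer `[m]_q = 1 + q + ⋯ + q^(m-1)`. -/
def qInt {R : Type*} [CommRing R] (m : ℕ) (q : R) : R := ∑ i ∈ Finset.range m, q ^ i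

/-- The matrix of the `k`-th twist box. -/
noncomputable def boxMatrix (a : ℕ → ℤ) (k : ℕ) : Matrix (Fin 2) (Fin 2) (LaurentPolynomial ℤ) :=
  !![-((varA ^ (2 * (-1) ^ k * (a k).sign) : (LaurentPolynomial ℤ)ˣ) : LaurentPolynomial ℤ)
        * qInt (a k).natAbs
            (-((varA ^ (4 * (-1) ^ k * (a k).sign) : (LaurentPolynomial ℤ)ˣ) :
              LaurentPolynomial ℤ)),
      (((-(varA ^ (4 * (-1) ^ k : ℤ))) ^ (a k) : (LaurentPolynomial ℤ)ˣ) : LaurentPolynomial ℤ);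
    1, 0]

/-- The product `Mₙ ⋯ M₁`, with the factor of the last twist box at the left. -/
noncomputable def boxMatrixProduct (n : ℕ) (a : ℕ → ℤ) :
    Matrix (Fin 2) (Fin 2) (LaurentPolynomial ℤ) :=
  ((List.range' 1 n).reverse.map (boxMatrix a)).prod

end RationalLink

namespace RationalLink

open LaurentPolynomial

/-! Fix the right part of a diagram and let the left closing vary over the two possibilities; the
two resulting brackets form a vector. Put a crossing in front. Its horizontal smoothing leaves the
left closing as it was. Its vertical smoothing either splits off a loop, when the closing joins the
two strands (`card_components_vertical_of_caps`), or exchanges the two closings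
(`card_components_vertical_of_not_caps`). So each crossing acts linearly, by `crossingStep`, and the
bracket is obtained by applying these maps from right to left to the vector of the right closing.

Let `δ` be `A` or `A⁻¹`, the coefficient of the vertical smoothing. If `R` joins the strands of the
crossing, the vector of `R` is an eigenvector with eigenvalue `δ⁻¹ + δd = -δ³` (a curl), while that
of the other closing goes to `δ⁻¹` times itself plus `δ` times the vector of `R`. The powers of this
triangular map give the `q`-integer with `q = -δ⁻⁴`, the ratio of the eigenvalues; the factored-out
powers of `-δ³` give the power of `-A`. Consecutive boxes exchange the roles of the two closings,
which accounts for the second row `1, 0` of each matrix. -/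

/-- The arcs of the crossingless diagram obtained from the list `l` of crossings by the smoothings
`s`, with the left ends joined as in `L` and the right ends joined as in `R`. -/
inductive SmoothedArc (L R : Closing) (l : List Crossing) (s : Fin l.length → Bool) :
    Fin (l.length + 1) × Fin 4 → Fin (l.length + 1) × Fin 4 → Prop
  | through (t : Fin l.length) (j : Fin 4)
      (h : (l.get t).vertical (s t) = true → j ≠ (l.get t).upper ∧ j ≠ (l.get t).lower) :
      SmoothedArc L R l s (t.castSucc, j) (t.succ, j)
  | vertical_left (t : Fin l.length) (h : (l.get t).vertical (s t) = true) :
      SmoothedArc L R l s (t.castSucc, (l.get t).upper) (t.castSucc, (l.get t).lower)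
  | vertical_right (t : Fin l.length) (h : (l.get t).vertical (s t) = true) :
      SmoothedArc L R l s (t.succ, (l.get t).upper) (t.succ, (l.get t).lower)
  | left (i j : Fin 4) (h : L.Joins i j) : SmoothedArc L R l s (0, i) (0, j)
  | right (i j : Fin 4) (h : R.Joins i j) :
      SmoothedArc L R l s (Fin.last l.length, i) (Fin.last l.length, j)

/-- The components of a smoothed diagram. -/
abbrev Components (L R : Closing) (l : List Crossing) (s : Fin l.length → Bool) : Type :=
  Quot (SmoothedArc L R l s)

instance (L R : Closing) (l : List Crossing) (s : Fin l.length → Bool) :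
    Finite (Components L R l s) := Quot.finite _

instance (L R : Closing) (l : List Crossing) (s : Fin l.length → Bool) :
    Nonempty (Components L R l s) := ⟨Quot.mk _ (0, 0)⟩

/-- The recursion changes the left closing, so it must be a parameter; `through` unites passing
strands with horizontal smoothings. -/
theorem Diagram.arc_iff_smoothedArc (D : Diagram) (s : D.State) (p q : D.Point) :
    D.Arc s p q ↔ SmoothedArc Closing.side D.closing D.crossings s p q := by
  constructor
  · rintro (⟨t, j, hu, hl⟩ | ⟨t, h⟩ | ⟨t, h⟩ | ⟨t, h⟩ | ⟨t, h⟩ | _ | _ | ⟨i, j, h⟩)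
    · exact .through t j fun _ => ⟨hu, hl⟩
    · exact .through t _ fun h' => absurd (h.symm.trans h') (by simp)
    · exact .through t _ fun h' => absurd (h.symm.trans h') (by simp)
    · exact .vertical_left t h
    · exact .vertical_right t h
    · exact .left 0 1 .side_top
    · exact .left 2 3 .side_bottom
    · exact .right i j h
  · rintro (⟨t, j, h⟩ | ⟨t, h⟩ | ⟨t, h⟩ | ⟨i, j, h⟩ | ⟨i, j, h⟩)
    · cases hv : (D.crossings.get t).vertical (s t) with
      | true => exact .pass t j (h hv).1 (h hv).2
      | false =>
        by_cases hu : j = (D.crossings.get t).upper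
        · subst hu; exact .horizontal_upper t hv
        by_cases hl : j = (D.crossings.get t).lower
        · subst hl; exact .horizontal_lower t hv
        exact .pass t j hu hl
    · exact .vertical_left t h
    · exact .vertical_right t h
    · cases h
      exacts [.left_top, .left_bottom]
    · exact .right i j h

theorem Diagram.loops_eq (D : Diagram) (s : D.State) :
    D.loops s = Nat.card (Components Closing.side D.closing D.crossings s) := by
  have h : D.Arc s = SmoothedArc Closing.side D.closing D.crossings s := by
    ext p q; exact D.arc_iff_smoothedArc s p q
  rw [Diagram.loops, h]

/-! ### Removing the leftmost slice: effect on the number of loops -/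

section Peel

variable {L L' R : Closing} {c : Crossing} {b : Bool} {l : List Crossing}
  {s : Fin l.length → Bool}

/-- The component of a point on the first cutting line of a diagram with at least one crossing. -/
abbrev firstLine (L R : Closing) (c : Crossing) (b : Bool) (l : List Crossing)
    (s : Fin l.length → Bool) (j : Fin 4) :
    Components L R (c :: l) (Fin.cons b s : Fin (l.length + 1) → Bool) :=
  Quot.mk _ ((0 : Fin (l.length + 2)), j)

/-- The component of a point on one of the later cutting lines. -/
abbrev laterLine (L R : Closing) (c : Crossing) (b : Bool) (l : List Crossing)
    (s : Fin l.length → Bool) (p : Fin (l.length + 1) × Fin 4) :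
    Components L R (c :: l) (Fin.cons b s : Fin (l.length + 1) → Bool) :=
  Quot.mk _ ((p.1.succ : Fin (l.length + 2)), p.2)

theorem firstLine_eq_laterLine (j : Fin 4)
    (h : c.vertical b = true → j ≠ c.upper ∧ j ≠ c.lower) :
    firstLine L R c b l s j = laterLine L R c b l s (0, j) :=
  Quot.sound (SmoothedArc.through (l := c :: l)
    (s := (Fin.cons b s : Fin (l.length + 1) → Bool)) (0 : Fin (l.length + 1)) j h)

theorem firstLine_upper (h : c.vertical b = true) :
    firstLine L R c b l s c.upper = firstLine L R c b l s c.lower :=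
  Quot.sound (SmoothedArc.vertical_left (l := c :: l)
    (s := (Fin.cons b s : Fin (l.length + 1) → Bool)) (0 : Fin (l.length + 1)) h)

theorem laterLine_upper (h : c.vertical b = true) :
    laterLine L R c b l s (0, c.upper) = laterLine L R c b l s (0, c.lower) :=
  Quot.sound (SmoothedArc.vertical_right (l := c :: l)
    (s := (Fin.cons b s : Fin (l.length + 1) → Bool)) (0 : Fin (l.length + 1)) h)

theorem firstLine_joins {i j : Fin 4} (h : L.Joins i j) :
    firstLine L R c b l s i = firstLine L R c b l s j :=
  Quot.sound (SmoothedArc.left (l := c :: l)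
    (s := (Fin.cons b s : Fin (l.length + 1) → Bool)) i j h)

/-- A map from the components of a diagram to a type, given by its values on the first cutting line
and by a map from the components of the diagram without its first crossing. -/
def peel {X : Type*} (φ : Fin 4 → X) (f : Components L' R l s → X)
    (hφ : ∀ j, (c.vertical b = true → j ≠ c.upper ∧ j ≠ c.lower) → φ j = f (Quot.mk _ (0, j)))
    (hv : c.vertical b = true → φ c.upper = φ c.lower)
    (hf : c.vertical b = true → f (Quot.mk _ (0, c.upper)) = f (Quot.mk _ (0, c.lower)))
    (hL : ∀ i j, L.Joins i j → φ i = φ j) :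
    Components L R (c :: l) (Fin.cons b s : Fin (l.length + 1) → Bool) → X :=
  Quot.lift (fun p => Fin.cases (motive := fun _ => X) (φ p.2) (fun t => f (Quot.mk _ (t, p.2))) p.1)
    (by
      rintro p q (⟨t, j, h⟩ | ⟨t, h⟩ | ⟨t, h⟩ | ⟨i, j, h⟩ | ⟨i, j, h⟩)
      · induction t using Fin.cases with
        | zero => exact hφ j h
        | succ t => exact congrArg f (Quot.sound (.through t j h))
      · induction t using Fin.cases with
        | zero => exact hv h
        | succ t => exact congrArg f (Quot.sound (.vertical_left t h))
      · induction t using Fin.cases with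
        | zero => exact hf h
        | succ t => exact congrArg f (Quot.sound (.vertical_right t h))
      · exact hL i j h
      · exact congrArg f (Quot.sound (.right i j h)))

/-- The map on components induced by the inclusion of the later slices of a diagram. -/
def unpeel (h : ∀ i j, L'.Joins i j →
      laterLine L R c b l s (0, i) = laterLine L R c b l s (0, j)) :
    Components L' R l s → Components L R (c :: l) (Fin.cons b s : Fin (l.length + 1) → Bool) :=
  Quot.lift (laterLine L R c b l s)
    (by
      rintro p q (⟨t, j, h'⟩ | ⟨t, h'⟩ | ⟨t, h'⟩ | ⟨i, j, h'⟩ | ⟨i, j, h'⟩)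
      · exact Quot.sound (SmoothedArc.through (l := c :: l)
          (s := (Fin.cons b s : Fin (l.length + 1) → Bool)) t.succ j h')
      · exact Quot.sound (SmoothedArc.vertical_left (l := c :: l)
          (s := (Fin.cons b s : Fin (l.length + 1) → Bool)) t.succ h')
      · exact Quot.sound (SmoothedArc.vertical_right (l := c :: l)
          (s := (Fin.cons b s : Fin (l.length + 1) → Bool)) t.succ h')
      · exact h i j h'
      · exact Quot.sound (SmoothedArc.right (l := c :: l)
          (s := (Fin.cons b s : Fin (l.length + 1) → Bool)) i j h'))

theorem components_cons_induction
    {P : Components L R (c :: l) (Fin.cons b s : Fin (l.length + 1) → Bool) → Prop}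
    (h₁ : ∀ j, P (firstLine L R c b l s j)) (h₂ : ∀ p, P (laterLine L R c b l s p)) (x) : P x := by
  obtain ⟨⟨t, j⟩, rfl⟩ := Quot.exists_rep x
  induction t using Fin.cases with
  | zero => exact h₁ j
  | succ t => exact h₂ (t, j)

/-- All four strands run straight across the slice, so the left closing slides past it. -/
theorem card_components_horizontal (h : c.vertical b = false) :
    Nat.card (Components L R (c :: l) (Fin.cons b s : Fin (l.length + 1) → Bool)) =
      Nat.card (Components L R l s) := by
  have hv : c.vertical b ≠ true := by simp [h]
  refine Nat.card_congr
    { toFun := peel (fun j => Quot.mk _ (0, j)) id (fun _ _ => rfl) (fun h => (hv h).elim)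
        (fun h => (hv h).elim) (fun i j h => Quot.sound (.left i j h))
      invFun := unpeel fun i j h => ?_
      left_inv := ?_
      right_inv := ?_ }
  · rw [← firstLine_eq_laterLine i fun h => (hv h).elim,
      ← firstLine_eq_laterLine j fun h => (hv h).elim, firstLine_joins h]
  · refine components_cons_induction (fun j => ?_) fun p => rfl
    exact (firstLine_eq_laterLine j fun h => (hv h).elim).symm
  · rintro ⟨p⟩; rfl

/-- Whether a closing joins the two strands that meet at a crossing. -/
def Closing.caps : Closing → Crossing → Bool
  | .side, c => c.pos ≠ 1
  | .nested, c => c.pos = 1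

/-- The other closing. -/
def Closing.other : Closing → Closing
  | .side => .nested
  | .nested => .side

theorem Closing.joins_of_caps (h : L.caps c = true) : L.Joins c.upper c.lower := by
  obtain ⟨pos, r⟩ := c
  cases L <;> fin_cases pos <;> simp [Closing.caps] at h
  exacts [.side_top, .side_bottom, .nested_inner]

theorem Closing.eq_or_ne_of_joins (h : L.caps c = true) {i j : Fin 4} (hij : L.Joins i j) :
    (i = c.upper ∧ j = c.lower) ∨
      (i ≠ c.upper ∧ i ≠ c.lower) ∧ (j ≠ c.upper ∧ j ≠ c.lower) := by
  obtain ⟨pos, r⟩ := c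
  cases hij <;> fin_cases pos <;> revert h <;>
    simp [Closing.caps, Crossing.upper, Crossing.lower]

/-- The left arc of the smoothing and the arc of `L` form a separate loop, recorded as `none`; the
right arc replaces the lost arc of `L`. -/
theorem card_components_vertical_of_caps (h : c.vertical b = true) (hc : L.caps c = true) :
    Nat.card (Components L R (c :: l) (Fin.cons b s : Fin (l.length + 1) → Bool)) =
      Nat.card (Components L R l s) + 1 := by
  rw [← Finite.card_option]
  have hu : Quot.mk (SmoothedArc L R l s) (0, c.upper) = Quot.mk _ (0, c.lower) :=
    Quot.sound (.left _ _ (Closing.joins_of_caps hc))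
  refine Nat.card_congr
    { toFun := peel (fun j => if j = c.upper ∨ j = c.lower then none else some (Quot.mk _ (0, j)))
        some (fun j hj => ?_) (fun _ => by simp) (fun _ => congrArg some hu) (fun i j hij => ?_)
      invFun := fun x => x.elim (firstLine L R c b l s c.upper) (unpeel fun i j hij => ?_)
      left_inv := ?_
      right_inv := ?_ }
  · simp [hj h]
  · obtain ⟨rfl, rfl⟩ | ⟨hi, hj⟩ := Closing.eq_or_ne_of_joins hc hij
    · simp
    · simpa [hi, hj] using Quot.sound (.left i j hij)
  · obtain ⟨rfl, rfl⟩ | ⟨hi, hj⟩ := Closing.eq_or_ne_of_joins hc hij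
    · exact laterLine_upper h
    · rw [← firstLine_eq_laterLine i fun _ => hi, ← firstLine_eq_laterLine j fun _ => hj,
        firstLine_joins hij]
  · refine components_cons_induction (fun j => ?_) fun p => rfl
    simp only [peel, firstLine, Fin.cases_zero]
    split_ifs with hj
    · obtain rfl | rfl := hj
      · rfl
      · exact firstLine_upper h
    · rw [not_or] at hj
      exact (firstLine_eq_laterLine j fun _ => hj).symm
  · rintro (_ | ⟨⟨p⟩⟩)
    · simp [peel]
    · rfl

/-- The strand to which a closing joins a strand. -/
def Closing.partner : Closing → Fin 4 → Fin 4
  | .side => ![1, 0, 3, 2]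
  | .nested => ![3, 2, 1, 0]

theorem Closing.eq_partner_of_joins {i j : Fin 4} (h : L.Joins i j) :
    j = L.partner i ∧ i = L.partner j := by
  cases h <;> simp [Closing.partner]

theorem firstLine_partner (j : Fin 4) :
    firstLine L R c b l s (L.partner j) = firstLine L R c b l s j := by
  cases L <;> fin_cases j
  exacts [(firstLine_joins .side_top).symm, firstLine_joins .side_top,
    (firstLine_joins .side_bottom).symm, firstLine_joins .side_bottom,
    (firstLine_joins .nested_outer).symm, (firstLine_joins .nested_inner).symm,
    firstLine_joins .nested_inner, firstLine_joins .nested_outer]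

theorem Closing.partner_ne (hc : L.caps c = false) {j : Fin 4} (hj : j = c.upper ∨ j = c.lower) :
    L.partner j ≠ c.upper ∧ L.partner j ≠ c.lower := by
  obtain ⟨pos, r⟩ := c
  cases L <;> fin_cases pos <;> simp [Closing.caps] at hc <;> obtain rfl | rfl := hj <;>
    simp [Closing.partner, Crossing.upper, Crossing.lower]

theorem Closing.other_joins_partner (hc : L.caps c = false) :
    L.other.Joins (L.partner c.upper) (L.partner c.lower) ∨
      L.other.Joins (L.partner c.lower) (L.partner c.upper) := by
  obtain ⟨pos, r⟩ := c
  cases L <;> fin_cases pos <;> simp [Closing.caps] at hc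
  exacts [.inl .nested_outer, .inr .side_bottom, .inr .side_top]

theorem Closing.other_joins_cases (hc : L.caps c = false) {i j : Fin 4} (h : L.other.Joins i j) :
    (i = c.upper ∧ j = c.lower) ∨ (i = L.partner c.upper ∧ j = L.partner c.lower) ∨
      (i = L.partner c.lower ∧ j = L.partner c.upper) := by
  obtain ⟨pos, r⟩ := c
  cases L <;> cases h <;> fin_cases pos <;> revert hc <;>
    simp [Closing.caps, Closing.partner, Crossing.upper, Crossing.lower]

theorem Closing.caps_other (hc : L.caps c = false) : L.other.caps c = true := by
  cases L <;> simpa [Closing.caps, Closing.other] using hc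

theorem Closing.eq_or_of_joins (hc : L.caps c = false) {i j : Fin 4} (h : L.Joins i j) :
    ((i = c.upper ∨ i = c.lower) ∧ ¬(j = c.upper ∨ j = c.lower)) ∨
      ((j = c.upper ∨ j = c.lower) ∧ ¬(i = c.upper ∨ i = c.lower)) := by
  obtain ⟨pos, r⟩ := c
  cases h <;> fin_cases pos <;> revert hc <;>
    simp [Closing.caps, Crossing.upper, Crossing.lower]

/-- The left arc of the smoothing links the two arcs of `L` into one arc between the two passing
strands; with the right arc this makes up the other closing. -/
theorem card_components_vertical_of_not_caps (h : c.vertical b = true) (hc : L.caps c = false) :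
    Nat.card (Components L R (c :: l) (Fin.cons b s : Fin (l.length + 1) → Bool)) =
      Nat.card (Components L.other R l s) := by
  have hu : Quot.mk (SmoothedArc L.other R l s) (0, c.upper) = Quot.mk _ (0, c.lower) :=
    Quot.sound (.left _ _ (Closing.joins_of_caps (Closing.caps_other hc)))
  have hp : Quot.mk (SmoothedArc L.other R l s) (0, L.partner c.upper) =
      Quot.mk _ (0, L.partner c.lower) := by
    obtain h | h := Closing.other_joins_partner hc
    · exact Quot.sound (.left _ _ h)
    · exact (Quot.sound (.left _ _ h)).symm
  have hp' : laterLine L R c b l s (0, L.partner c.upper) =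
      laterLine L R c b l s (0, L.partner c.lower) := by
    rw [← firstLine_eq_laterLine _ fun _ => Closing.partner_ne hc (.inl rfl),
      ← firstLine_eq_laterLine _ fun _ => Closing.partner_ne hc (.inr rfl),
      firstLine_partner, firstLine_partner, firstLine_upper h]
  refine Nat.card_congr
    { toFun := peel
        -- A strand stopped by the left arc is followed back through `L` to its partner, which does
        -- cross the slice.
        (fun j => Quot.mk _ (0, if j = c.upper ∨ j = c.lower then L.partner j else j))
        id (fun j hj => ?_) (fun _ => by simpa using hp) (fun _ => hu) (fun i j hij => ?_)
      invFun := unpeel fun i j hij => ?_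
      left_inv := ?_
      right_inv := ?_ }
  · simp [hj h]
  · obtain ⟨hj, hi⟩ := Closing.eq_partner_of_joins hij
    obtain ⟨h₁, h₂⟩ | ⟨h₁, h₂⟩ := Closing.eq_or_of_joins hc hij
    · simp only [if_pos h₁, if_neg h₂, ← hj]
    · simp only [if_pos h₁, if_neg h₂, ← hi]
  · obtain ⟨rfl, rfl⟩ | ⟨rfl, rfl⟩ | ⟨rfl, rfl⟩ := Closing.other_joins_cases hc hij
    · exact laterLine_upper h
    · exact hp'
    · exact hp'.symm
  · refine components_cons_induction (fun j => ?_) fun p => rfl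
    simp only [peel, firstLine, Fin.cases_zero]
    split_ifs with hj
    · exact (firstLine_eq_laterLine _ fun _ => Closing.partner_ne hc hj).symm.trans
        (firstLine_partner j)
    · rw [not_or] at hj
      exact (firstLine_eq_laterLine j fun _ => hj).symm
  · rintro ⟨p⟩; rfl

end Peel

/-! ### The bracket as a composite of linear maps -/

/-- The linear map by which a crossing acts on the values of its left closings: `δ` is the
coefficient of its vertical smoothing. -/
noncomputable def crossingStep (δ : ℤ[T;T⁻¹]ˣ) (c : Crossing) (v : Closing → ℤ[T;T⁻¹]) :
    Closing → ℤ[T;T⁻¹] := fun L =>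
  (δ⁻¹ : ℤ[T;T⁻¹]ˣ) * v L + δ * if L.caps c then loopValue * v L else v L.other

/-- The coefficient of the vertical smoothing of a crossing. -/
noncomputable def Crossing.verticalCoeff (c : Crossing) : ℤ[T;T⁻¹]ˣ :=
  if c.rising then varA else varA⁻¹

/-- The Kauffman bracket of a list of crossings with both ends closed. -/
noncomputable def closedBracket (R : Closing) (l : List Crossing) (L : Closing) : ℤ[T;T⁻¹] :=
  ∑ s : Fin l.length → Bool,
    (∏ t, if s t then (varA : ℤ[T;T⁻¹]) else ((varA⁻¹ : ℤ[T;T⁻¹]ˣ) : ℤ[T;T⁻¹]))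
      * loopValue ^ (Nat.card (Components L R l s) - 1)

theorem Diagram.bracket_eq (D : Diagram) :
    D.bracket = closedBracket D.closing D.crossings .side := by
  simp only [Diagram.bracket, closedBracket, Diagram.loops_eq]

theorem loopValue_pow_cons_horizontal (R L : Closing) (c : Crossing) (l : List Crossing)
    (s : Fin l.length → Bool) {b : Bool} (h : c.vertical b = false) :
    loopValue ^ (Nat.card (Components L R (c :: l)
      (Fin.cons b s : Fin (l.length + 1) → Bool)) - 1) =
      loopValue ^ (Nat.card (Components L R l s) - 1) := by
  rw [card_components_horizontal h]

theorem loopValue_pow_cons_vertical (R L : Closing) (c : Crossing) (l : List Crossing)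
    (s : Fin l.length → Bool) {b : Bool} (h : c.vertical b = true) :
    loopValue ^ (Nat.card (Components L R (c :: l)
      (Fin.cons b s : Fin (l.length + 1) → Bool)) - 1) =
      if L.caps c then loopValue * loopValue ^ (Nat.card (Components L R l s) - 1)
      else loopValue ^ (Nat.card (Components L.other R l s) - 1) := by
  cases hc : L.caps c with
  | true =>
    -- Since the exponent is a truncated difference, the extra factor `d` needs at least one
    -- remaining loop.
    have : 0 < Nat.card (Components L R l s) := Nat.card_pos
    rw [card_components_vertical_of_caps h hc, if_pos rfl, ← pow_succ']
    congr 1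
    omega
  | false =>
    rw [card_components_vertical_of_not_caps h hc]
    simp

/-- The state sum splits according to the smoothing of the first crossing. The `A`-smoothing is the
vertical one exactly for a rising crossing. -/
theorem closedBracket_cons (R : Closing) (c : Crossing) (l : List Crossing) :
    closedBracket R (c :: l) = crossingStep c.verticalCoeff c (closedBracket R l) := by
  funext L
  have key : closedBracket R (c :: l) L = ∑ b : Bool, ∑ s : Fin l.length → Bool,
      (if b then (varA : ℤ[T;T⁻¹]) else ((varA⁻¹ : ℤ[T;T⁻¹]ˣ) : ℤ[T;T⁻¹])) *
        ((∏ t, if s t then (varA : ℤ[T;T⁻¹]) else ((varA⁻¹ : ℤ[T;T⁻¹]ˣ) : ℤ[T;T⁻¹])) *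
        loopValue ^ (Nat.card (Components L R (c :: l)
          (Fin.cons b s : Fin (l.length + 1) → Bool)) - 1)) := by
    rw [closedBracket, ← Fintype.sum_prod_type']
    refine (Fintype.sum_equiv (Fin.consEquiv fun _ : Fin (l.length + 1) => Bool) _ _ ?_).symm
    rintro ⟨b, s⟩
    rw [← mul_assoc]
    refine congrArg₂ _ ?_ rfl
    exact (Fin.prod_univ_succ (n := l.length) fun t =>
      if (Fin.cons b s : Fin (l.length + 1) → Bool) t then (varA : ℤ[T;T⁻¹])
      else ((varA⁻¹ : ℤ[T;T⁻¹]ˣ) : ℤ[T;T⁻¹])).symm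
  have hor (b : Bool) (h : c.vertical b = false) : ∑ s : Fin l.length → Bool,
      ((∏ t, if s t then (varA : ℤ[T;T⁻¹]) else ((varA⁻¹ : ℤ[T;T⁻¹]ˣ) : ℤ[T;T⁻¹])) *
        loopValue ^ (Nat.card (Components L R (c :: l)
          (Fin.cons b s : Fin (l.length + 1) → Bool)) - 1)) = closedBracket R l L :=
    Finset.sum_congr rfl fun s _ => by rw [loopValue_pow_cons_horizontal R L c l s h]
  have ver (b : Bool) (h : c.vertical b = true) : ∑ s : Fin l.length → Bool,
      ((∏ t, if s t then (varA : ℤ[T;T⁻¹]) else ((varA⁻¹ : ℤ[T;T⁻¹]ˣ) : ℤ[T;T⁻¹])) *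
        loopValue ^ (Nat.card (Components L R (c :: l)
          (Fin.cons b s : Fin (l.length + 1) → Bool)) - 1)) =
      if L.caps c then loopValue * closedBracket R l L else closedBracket R l L.other := by
    simp only [loopValue_pow_cons_vertical R L c l _ h]
    split_ifs
    · rw [closedBracket, Finset.mul_sum]
      exact Finset.sum_congr rfl fun s _ => by ring
    · rfl
  rw [key, Fintype.sum_bool, ← Finset.mul_sum, ← Finset.mul_sum, crossingStep]
  cases hr : c.rising with
  | true =>
    rw [ver true (by simp [Crossing.vertical, hr]), hor false (by simp [Crossing.vertical, hr])]
    simp [Crossing.verticalCoeff, hr, add_comm]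
  | false =>
    rw [hor true (by simp [Crossing.vertical, hr]), ver false (by simp [Crossing.vertical, hr])]
    simp [Crossing.verticalCoeff, hr]

/-! ### Diagrams without crossings -/

/-- The brackets of the two closings at the left of a diagram without crossings. -/
noncomputable def closingVector (R : Closing) (L : Closing) : ℤ[T;T⁻¹] :=
  match R, L with
  | .side, .side => loopValue
  | .nested, .nested => loopValue
  | _, _ => 1

theorem card_components_nil (R L : Closing) (s : Fin ([] : List Crossing).length → Bool) :
    Nat.card (Components L R [] s) =
      match R, L with
      | .side, .side => 2
      | .nested, .nested => 2
      | _, _ => 1 := by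
  have arc {i j : Fin 4} (h : L.Joins i j ∨ R.Joins i j) :
      (Quot.mk _ (0, i) : Components L R [] s) = Quot.mk _ (0, j) := by
    obtain h | h := h
    · exact Quot.sound (.left i j h)
    · exact Quot.sound (.right i j h)
  have point (P : Components L R [] s → Prop) (h : ∀ j : Fin 4, P (Quot.mk _ (0, j))) (x) : P x := by
    obtain ⟨⟨t, j⟩, rfl⟩ := Quot.exists_rep x
    obtain rfl : t = 0 := Subsingleton.elim (α := Fin 1) t 0
    exact h j
  -- A colouring constant on arcs separates the components; every point is joined to the
  -- representative of its colour.
  have two (f : Fin 4 → Bool) (i₀ i₁ : Fin 4) (h₀ : f i₀ = false) (h₁ : f i₁ = true)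
      (hL : ∀ i j, L.Joins i j → f i = f j) (hR : ∀ i j, R.Joins i j → f i = f j)
      (h : ∀ j : Fin 4, (Quot.mk _ (0, j) : Components L R [] s) =
        Quot.mk _ (0, if f j then i₁ else i₀)) :
      Nat.card (Components L R [] s) = 2 := by
    rw [show 2 = Nat.card Bool by simp]
    refine Nat.card_congr
      { toFun := Quot.lift (fun p => f p.2) ?_
        invFun := fun b => Quot.mk _ (0, if b then i₁ else i₀)
        left_inv := point _ fun j => (h j).symm
        right_inv := by rintro (_ | _) <;> simp [h₀, h₁] }
    rintro p q (⟨t, j, h⟩ | ⟨t, h⟩ | ⟨t, h⟩ | ⟨i, j, h⟩ | ⟨i, j, h⟩)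
    · exact t.elim0
    · exact t.elim0
    · exact t.elim0
    · exact hL i j h
    · exact hR i j h
  have one (h : ∀ j : Fin 4, (Quot.mk _ (0, j) : Components L R [] s) = Quot.mk _ (0, 0)) :
      Nat.card (Components L R [] s) = 1 := by
    rw [Nat.card_eq_one_iff_unique]
    refine ⟨⟨fun x y => ?_⟩, inferInstance⟩
    have h' (x) : x = (Quot.mk _ (0, 0) : Components L R [] s) :=
      point (fun x => x = Quot.mk _ (0, 0)) h x
    rw [h' x, h' y]
  cases R <;> cases L <;> simp only
  · refine two ![false, false, true, true] 0 2 rfl rfl ?_ ?_ fun j => ?_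
    · rintro _ _ (_ | _) <;> rfl
    · rintro _ _ (_ | _) <;> rfl
    · fin_cases j
      exacts [rfl, (arc (.inl .side_top)).symm, rfl, (arc (.inl .side_bottom)).symm]
  · have h₁ := arc (.inr .side_top)
    have h₂ := arc (.inl .nested_inner)
    have h₃ := arc (.inl .nested_outer)
    refine one fun j => ?_
    fin_cases j
    exacts [rfl, h₁.symm, (h₁.trans h₂).symm, h₃.symm]
  · have h₁ := arc (.inl .side_top)
    have h₂ := arc (.inr .nested_inner)
    have h₃ := arc (.inr .nested_outer)
    refine one fun j => ?_
    fin_cases j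
    exacts [rfl, h₁.symm, (h₁.trans h₂).symm, h₃.symm]
  · refine two ![false, true, true, false] 0 1 rfl rfl ?_ ?_ fun j => ?_
    · rintro _ _ (_ | _) <;> rfl
    · rintro _ _ (_ | _) <;> rfl
    · fin_cases j
      exacts [rfl, rfl, (arc (.inl .nested_inner)).symm, (arc (.inl .nested_outer)).symm]

theorem closedBracket_nil (R : Closing) : closedBracket R [] = closingVector R := by
  funext L
  rw [closedBracket]
  simp only [card_components_nil]
  cases R <;> cases L <;> simp [closingVector]

theorem closedBracket_eq_foldr (R : Closing) (l : List Crossing) :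
    closedBracket R l =
      l.foldr (fun c v => crossingStep c.verticalCoeff c v) (closingVector R) := by
  induction l with
  | nil => exact closedBracket_nil R
  | cons c l ih => rw [closedBracket_cons, ih, List.foldr_cons]

/-! ### The action of one twist box -/

theorem Closing.caps_other_eq_false {R : Closing} {c : Crossing} (hc : R.caps c = true) :
    R.other.caps c = false := by
  cases R <;> simpa [Closing.caps, Closing.other] using hc

/-- The triangular form: `hδ` turns `δ⁻¹ + δd` into the curl factor `-δ³`. -/
theorem crossingStep_closingVector {δ : ℤ[T;T⁻¹]ˣ}
    (hδ : loopValue = -(δ : ℤ[T;T⁻¹]) ^ 2 - ((δ⁻¹ : ℤ[T;T⁻¹]ˣ) : ℤ[T;T⁻¹]) ^ 2)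
    {c : Crossing} {R : Closing} (hc : R.caps c = true) (x y : ℤ[T;T⁻¹]) :
    crossingStep δ c (x • closingVector R.other + y • closingVector R) =
      (x * (δ⁻¹ : ℤ[T;T⁻¹]ˣ)) • closingVector R.other +
        (x * δ - y * (δ : ℤ[T;T⁻¹]) ^ 3) • closingVector R := by
  have hu : (δ : ℤ[T;T⁻¹]) * ((δ⁻¹ : ℤ[T;T⁻¹]ˣ) : ℤ[T;T⁻¹]) = 1 := δ.mul_inv
  have hc' := Closing.caps_other_eq_false hc
  funext L
  simp only [crossingStep]
  generalize ((δ⁻¹ : ℤ[T;T⁻¹]ˣ) : ℤ[T;T⁻¹]) = e at *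
  generalize (δ : ℤ[T;T⁻¹]) = f at *
  cases R <;> cases L <;> simp only [Closing.other] at hc' <;>
    simp only [hc, hc', closingVector, Closing.other, Pi.add_apply, Pi.smul_apply, smul_eq_mul,
      if_true, Bool.false_eq_true, if_false, mul_one]
  · linear_combination y * loopValue * f * hδ - y * loopValue * e * hu
  · linear_combination y * f * hδ - y * e * hu
  · linear_combination y * f * hδ - y * e * hu
  · linear_combination y * loopValue * f * hδ - y * loopValue * e * hu

theorem qInt_succ {R : Type*} [CommRing R] (m : ℕ) (q : R) : qInt (m + 1) q = qInt m q + q ^ m :=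
  Finset.sum_range_succ _ _

/-- With `(-δ³)^m` factored out, the off-diagonal entry is a geometric sum of ratio `-δ⁻⁴`. -/
theorem crossingStep_iterate_closingVector {δ : ℤ[T;T⁻¹]ˣ}
    (hδ : loopValue = -(δ : ℤ[T;T⁻¹]) ^ 2 - ((δ⁻¹ : ℤ[T;T⁻¹]ˣ) : ℤ[T;T⁻¹]) ^ 2)
    {c : Crossing} {R : Closing} (hc : R.caps c = true) (x y : ℤ[T;T⁻¹]) (m : ℕ) :
    (crossingStep δ c)^[m] (x • closingVector R.other + y • closingVector R) =
      ((-(δ : ℤ[T;T⁻¹]) ^ 3) ^ m * (x * (-((δ⁻¹ : ℤ[T;T⁻¹]ˣ) : ℤ[T;T⁻¹]) ^ 4) ^ m)) •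
          closingVector R.other +
        ((-(δ : ℤ[T;T⁻¹]) ^ 3) ^ m * (x * (-((δ⁻¹ : ℤ[T;T⁻¹]ˣ) : ℤ[T;T⁻¹]) ^ 2 *
          qInt m (-((δ⁻¹ : ℤ[T;T⁻¹]ˣ) : ℤ[T;T⁻¹]) ^ 4)) + y)) • closingVector R := by
  have hu : (δ : ℤ[T;T⁻¹]) * ((δ⁻¹ : ℤ[T;T⁻¹]ˣ) : ℤ[T;T⁻¹]) = 1 := δ.mul_inv
  induction m with
  | zero => simp [qInt]
  | succ m ih =>
    rw [Function.iterate_succ_apply', ih, crossingStep_closingVector hδ hc, qInt_succ,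
      pow_succ _ m, pow_succ _ m]
    generalize ((δ⁻¹ : ℤ[T;T⁻¹]ˣ) : ℤ[T;T⁻¹]) = e at *
    generalize (δ : ℤ[T;T⁻¹]) = f at *
    generalize (-f ^ 3) ^ m = g
    generalize (-e ^ 4) ^ m = h
    -- After division by `-δ³`, the entries `δ` and `δ⁻¹` become `-δ⁻²` and `-δ⁻⁴`.
    have h₂ : f ^ 3 * e ^ 2 = f := by
      linear_combination f * (f * e + 1) * hu
    have h₃ : f ^ 3 * e ^ 4 = e := by
      linear_combination e ^ 2 * h₂ + e * hu
    congr 2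
    · linear_combination -g * x * h * h₃
    · linear_combination -g * x * h * h₂

/-- Here `ε` is the sign of the box parameter and `σ` its twist sign. The minus signs survive
because `3` is odd and `(-u)⁻¹ = -u⁻¹`. -/
theorem pow_neg_cube_eq {δ : ℤ[T;T⁻¹]ˣ} {σ ε : ℤ} (hδ : δ = varA ^ σ) (hσ : σ = 1 ∨ σ = -1)
    (hε : ε = 1 ∨ ε = -1) (m : ℕ) :
    (-δ ^ 3) ^ m = (-varA) ^ (3 * (σ * m)) ∧
      (-(varA ^ (-(4 * σ * ε)))) ^ (ε * m) = (-δ⁻¹ ^ 4) ^ m := by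
  subst hδ
  have h₁ : -(varA ^ σ) ^ 3 = (-varA) ^ (3 * σ) := by
    rw [mul_comm, zpow_mul]
    obtain rfl | rfl := hσ
    · simpa using (Odd.neg_pow (by decide) varA).symm
    · rw [zpow_neg_one, zpow_neg_one, inv_neg]
      exact (Odd.neg_pow (by decide) varA⁻¹).symm
  have h₂ : (-(varA ^ (-(4 * σ * ε)))) ^ ε = -(varA ^ σ)⁻¹ ^ 4 := by
    have h : (varA ^ σ)⁻¹ ^ 4 = varA ^ (-(4 * σ)) := by
      rw [← zpow_neg, ← zpow_natCast, ← zpow_mul]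
      congr 1
      push_cast
      ring
    rw [h]
    obtain rfl | rfl := hε
    · simp
    · rw [zpow_neg_one, inv_neg, ← zpow_neg]
      congr 2
      ring
  constructor
  · rw [h₁, ← zpow_natCast, ← zpow_mul, mul_assoc]
  · rw [zpow_mul, h₂, zpow_natCast]

theorem loopValue_eq_zpow {σ : ℤ} (hσ : σ = 1 ∨ σ = -1) :
    loopValue = -((varA ^ σ : ℤ[T;T⁻¹]ˣ) : ℤ[T;T⁻¹]) ^ 2 -
      (((varA ^ σ)⁻¹ : ℤ[T;T⁻¹]ˣ) : ℤ[T;T⁻¹]) ^ 2 := by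
  rw [loopValue, ← Units.val_pow_eq_pow_val, ← Units.val_pow_eq_pow_val]
  obtain rfl | rfl := hσ
  · rw [zpow_one, inv_pow, zpow_neg]
    rfl
  · rw [zpow_neg_one, inv_inv, inv_pow, zpow_neg]
    simp only [show varA ^ (2 : ℤ) = varA ^ 2 from rfl]
    ring

/-! ### Standard diagrams: induction on the number of boxes -/

/-- The closing at the right of the standard diagram with `n` twist boxes. -/
def standardClosing (n : ℕ) : Closing := if Odd n then .side else .nested

theorem standardClosing_succ (n : ℕ) : standardClosing (n + 1) = (standardClosing n).other := by
  by_cases h : Odd n <;> simp [standardClosing, h, Nat.odd_add_one, Closing.other]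

theorem Closing.other_other (R : Closing) : R.other.other = R := by cases R <;> rfl

/-- This parity match makes the closing of the shorter diagram the eigenvector for the next box. -/
theorem caps_boxCrossing (a : ℕ → ℤ) (n : ℕ) :
    (standardClosing n).caps (boxCrossing a (n + 1)) = true := by
  by_cases h : Odd n <;>
    simp [standardClosing, boxCrossing, h, Nat.odd_add_one, Closing.caps]

theorem verticalCoeff_boxCrossing (a : ℕ → ℤ) (n : ℕ) (h : a (n + 1) ≠ 0) :
    (boxCrossing a (n + 1)).verticalCoeff = varA ^ ((-1) ^ n * (a (n + 1)).sign) := by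
  have hσ : (-1) ^ n * (a (n + 1)).sign = 1 ∨ (-1) ^ n * (a (n + 1)).sign = -1 := by
    obtain h₁ | h₁ := neg_one_pow_eq_or ℤ n <;> obtain h₂ | h₂ := lt_or_gt_of_ne h <;>
      simp [h₁, h₂, Int.sign_eq_one_of_pos, Int.sign_eq_neg_one_of_neg]
  obtain hσ | hσ := hσ <;> simp [Crossing.verticalCoeff, boxCrossing, hσ]

theorem boxMatrixProduct_succ (n : ℕ) (a : ℕ → ℤ) :
    boxMatrixProduct (n + 1) a = boxMatrix a (n + 1) * boxMatrixProduct n a := by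
  simp [boxMatrixProduct, List.range'_1_concat, add_comm]

theorem standardDiagram_crossings_succ (n : ℕ) (a : ℕ → ℤ) :
    (standardDiagram (n + 1) a).crossings = (standardDiagram n a).crossings ++
      List.replicate (a (n + 1)).natAbs (boxCrossing a (n + 1)) := by
  simp [standardDiagram, List.range'_1_concat, add_comm]

theorem foldr_replicate {α β : Type*} (f : α → β → β) (x : α) (m : ℕ) (v : β) :
    (List.replicate m x).foldr f v = (f x)^[m] v := by
  induction m with
  | zero => rfl
  | succ m ih => rw [List.replicate_succ, List.foldr_cons, ih, Function.iterate_succ_apply']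

/-- Up to the power of `-A`, the row of coefficients `(x, y)` is multiplied on the right by the box
matrix, with the basis vectors exchanged. -/
theorem crossingStep_iterate_boxCrossing (a : ℕ → ℤ) (n : ℕ) (h : a (n + 1) ≠ 0)
    (x y : ℤ[T;T⁻¹]) :
    (crossingStep (boxCrossing a (n + 1)).verticalCoeff (boxCrossing a (n + 1)))^[(a (n + 1)).natAbs]
        (x • closingVector (standardClosing n).other + y • closingVector (standardClosing n)) =
      ((((-varA) ^ (3 * ((-1) ^ n * a (n + 1))) : ℤ[T;T⁻¹]ˣ) : ℤ[T;T⁻¹]) *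
          (x * boxMatrix a (n + 1) 0 0 + y)) • closingVector (standardClosing n) +
        ((((-varA) ^ (3 * ((-1) ^ n * a (n + 1))) : ℤ[T;T⁻¹]ˣ) : ℤ[T;T⁻¹]) *
          (x * boxMatrix a (n + 1) 0 1)) • closingVector (standardClosing n).other := by
  have hε : (a (n + 1)).sign = 1 ∨ (a (n + 1)).sign = -1 := by
    obtain h | h := lt_or_gt_of_ne h
    · exact .inr (Int.sign_eq_neg_one_of_neg h)
    · exact .inl (Int.sign_eq_one_of_pos h)
  have ha : a (n + 1) = (a (n + 1)).sign * (a (n + 1)).natAbs := (Int.sign_mul_natAbs _).symm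
  have hδ := verticalCoeff_boxCrossing a n h
  have hσ : (-1) ^ n * (a (n + 1)).sign = 1 ∨ (-1) ^ n * (a (n + 1)).sign = -1 := by
    obtain h₁ | h₁ := neg_one_pow_eq_or ℤ n <;> obtain h₂ | h₂ := hε <;> simp [h₁, h₂]
  have hl := loopValue_eq_zpow hσ
  obtain ⟨h₁, h₂⟩ := pow_neg_cube_eq hδ hσ hε (a (n + 1)).natAbs
  rw [← hδ] at hl
  have hε2 : (a (n + 1)).sign * (a (n + 1)).sign = 1 := by
    obtain h | h := hε <;> simp [h]
  have e₁ : 3 * ((-1) ^ n * a (n + 1)) =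
      3 * ((-1) ^ n * (a (n + 1)).sign * ((a (n + 1)).natAbs : ℤ)) := by
    rw [mul_assoc, ← ha]
  have e₂ : (4 * (-1) ^ (n + 1) : ℤ) =
      -(4 * ((-1) ^ n * (a (n + 1)).sign) * (a (n + 1)).sign) := by
    linear_combination 4 * (-1) ^ n * hε2
  have e₃ (k : ℕ) : varA ^ ((2 * k : ℕ) * (-1) ^ (n + 1) * (a (n + 1)).sign : ℤ) =
      (boxCrossing a (n + 1)).verticalCoeff⁻¹ ^ (2 * k) := by
    rw [hδ, ← zpow_neg, ← zpow_natCast, ← zpow_mul]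
    congr 1
    ring
  have m₀ : boxMatrix a (n + 1) 0 0 =
      -(((boxCrossing a (n + 1)).verticalCoeff⁻¹ : ℤ[T;T⁻¹]ˣ) : ℤ[T;T⁻¹]) ^ 2 *
        qInt (a (n + 1)).natAbs
          (-(((boxCrossing a (n + 1)).verticalCoeff⁻¹ : ℤ[T;T⁻¹]ˣ) : ℤ[T;T⁻¹]) ^ 4) := by
    rw [← Units.val_pow_eq_pow_val, ← Units.val_pow_eq_pow_val]
    exact congrArg₂ (fun u v : ℤ[T;T⁻¹]ˣ => -(u : ℤ[T;T⁻¹]) * qInt (a (n + 1)).natAbs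
      (-(v : ℤ[T;T⁻¹]))) (e₃ 1) (e₃ 2)
  have m₁ : boxMatrix a (n + 1) 0 1 =
      (-(((boxCrossing a (n + 1)).verticalCoeff⁻¹ : ℤ[T;T⁻¹]ˣ) : ℤ[T;T⁻¹]) ^ 4) ^
        (a (n + 1)).natAbs := by
    have : boxMatrix a (n + 1) 0 1 =
        (((-(varA ^ (4 * (-1) ^ (n + 1) : ℤ))) ^ (a (n + 1)) : ℤ[T;T⁻¹]ˣ) : ℤ[T;T⁻¹]) := rfl
    rw [this, e₂]
    conv_lhs => rw [show ∀ u : ℤ[T;T⁻¹]ˣ, u ^ (a (n + 1)) =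
      u ^ ((a (n + 1)).sign * ((a (n + 1)).natAbs : ℤ)) from fun u => by rw [← ha]]
    rw [h₂]
    simp
  rw [crossingStep_iterate_closingVector hl (caps_boxCrossing a n), m₀, m₁, e₁, ← h₁, add_comm]
  simp

/-- Absorbing the last box produces a mixture of both closings, so the induction needs arbitrary `x`
and `y`. Without boxes, evaluation at `.side` gives `x + y * d`, whence the final column. -/
theorem foldr_standardDiagram (n : ℕ) (a : ℕ → ℤ) (ha : ∀ k ∈ Finset.Icc 1 n, a k ≠ 0)
    (x y : ℤ[T;T⁻¹]) :
    (standardDiagram n a).crossings.foldr (fun c v => crossingStep c.verticalCoeff c v)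
        (x • closingVector (standardClosing n) + y • closingVector (standardClosing n).other)
        .side =
      (((-varA) ^ (3 * ∑ k ∈ Finset.Icc 1 n, (-1) ^ (k - 1) * a k) : ℤ[T;T⁻¹]ˣ) : ℤ[T;T⁻¹]) *
        (![x, y] ⬝ᵥ (boxMatrixProduct n a).mulVec ![1, loopValue]) := by
  induction n generalizing x y with
  | zero =>
    simp [standardDiagram, boxMatrixProduct, standardClosing, closingVector, Closing.other]
  | succ n ih =>
    rw [standardDiagram_crossings_succ, List.foldr_append, foldr_replicate, standardClosing_succ,
      Closing.other_other, crossingStep_iterate_boxCrossing a n (ha _ (by simp)),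
      ih fun k hk => ha k (by simp at hk ⊢; omega), Finset.sum_Icc_succ_top (by omega), mul_add (3 : ℤ),
      zpow_add, boxMatrixProduct_succ, ← Matrix.mulVec_mulVec]
    have r₀ : boxMatrix a (n + 1) 1 0 = 1 := rfl
    have r₁ : boxMatrix a (n + 1) 1 1 = 0 := rfl
    generalize (boxMatrixProduct n a).mulVec ![1, loopValue] = w
    simp only [dotProduct, Matrix.mulVec, Fin.sum_univ_two, r₀, r₁, Units.val_mul,
      Matrix.cons_val_zero, Matrix.cons_val_one, Nat.add_sub_cancel]
    ring

end RationalLink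

open RationalLink in
theorem theorem5p5 (n : ℕ) (a : ℕ → ℤ) (ha : ∀ k ∈ Finset.Icc 1 n, a k ≠ 0) :
    (standardDiagram n a).bracket =
      (((-varA) ^ (3 * ∑ k ∈ Finset.Icc 1 n, (-1) ^ (k - 1) * a k) : (LaurentPolynomial ℤ)ˣ) :
          LaurentPolynomial ℤ)
        * (![1, 0] ⬝ᵥ (boxMatrixProduct n a).mulVec ![1, loopValue]) := by
  -- The actual right closing is the case `x = 1`, `y = 0`.
  rw [Diagram.bracket_eq, closedBracket_eq_foldr, ← foldr_standardDiagram n a ha, one_smul,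
    zero_smul, add_zero]
  rfl
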